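/- Let $n,r\ge 0$ and let $g_i = x^{a_i}-x^{b_i}\in\mathbb{R}[x_1,\dots,x_n]$, $i=1,\dots,r$, with $a_i,b_i\in\mathbb{Z}_{\ge 0}^n$. Assume that $S=\{x\in\mathbb{R}^n : x_j\ge 0 \ (1\le j\le n),\ g_i(x)\ge 0\ (1\le i\le r)\}$ is full-dimensional, i.e. has non-empty interior in $\mathbb{R}^n$. For $d\in\mathbb{N}$ let $\mathbb{R}[x]_d$ be the space of polynomials of degree at most $d$. Put $g_0=1$, $g^I=\prod_{i\in I}g_i$ and $x^J=\prod_{j\in J}x_j$, and let $$\mathrm{QM}_d=\Big\{\sum_{J\subseteq[n],\,0\le i\le r}\sigma_{J,i}\,x^Jg_i\Big\},\qquad \mathrm{PO}_d=\Big\{\sum_{J\subseteq[n],\,I\subseteq[r]}\sigma_{J,I}\,x^Jg^I\Big\},$$ where all $\sigma_{J,i},\sigma_{J,I}$ are sums of squares of real polynomials and each summand has degree at most $d$. Let $\mathrm{QM}_d^\vee,\mathrm{PO}_d^\vee\subset\mathbb{R}[x]_d^*$ be the dual cones, i.e. the sets of linear functionals that are nonnegative on $\mathrm{QM}_d$, respectively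 $\mathrm{PO}_d$. A functional $\ell$ is identified with its coordinate vector $(\ell(x^\gamma))_{|\gamma|\le d}$. For a subset $T$ of $\mathbb{R}^m$, $\operatorname{trop}(T)=\lim_{t\to\infty}\{(\log_t|x_1|,\dots,\log_t|x_m|) : x\in T,\ x_1\cdots x_m\ne 0\}$ is its logarithmic limit set; that is, $y\in\operatorname{trop}(T)$ if and only if there are $t_k\to\infty$ and $x^{(k)}\in T$ with all coordinates non-zero such that $(\log_{t_k}|x^{(k)}_1|,\dots,\log_{t_k}|x^{(k)}_m|)\to y$. Let $A\subset\mathbb{Z}_{\ge 0}^n$ be finite, let $d\ge\max\{|\gamma|:\gamma\in A\}$, and for every $m\ge\max\{|\gamma|:\gamma\in A\}$ let $\pi_A$ be the projection of a vector indexed by $\{\gamma\in\mathbb{Z}_{\ge0}^n:|\gamma|\le m\}$ to its coordinates with index in $A$. Then: 1. $\pi_A(\operatorname{trop}(\mathrm{PO}_d^\vee))\subseteq\pi_A(\operatorname{trop}(\mathrm{QM}_d^\vee))$; 2. for all sufficiently large $D\in\mathbb{N}$, $\pi_A(\operatorname{trop}(\mathrm{QM}_D^\vee))\subseteq\pi_A(\operatorname{trop}(\mathrm{PO}_d^\vee))$.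 -/

import Mathlib

namespace TropMoment

open scoped Topology
open MvPolynomial

/-- The tropicalization (logarithmic limit set) of a subset `S` of `ℝ^ι`: the limit, as `t → ∞`, of
the sets `{(log_t |x i|)_i : x ∈ S, all x i ≠ 0}`. The limit of the family is the set of all limit
points of the family as `t → ∞`, i.e. the fibre at infinity of the closure of the total family. -/
def tropicalization {ι : Type*} (S : Set (ι → ℝ)) : Set (ι → ℝ) :=
  {y | ∀ U ∈ 𝓝 y, ∃ᶠ t : ℝ in Filter.atTop,
    ∃ x ∈ S, (∀ i, x i ≠ 0) ∧ (fun i => Real.logb t |x i|) ∈ U}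

variable {n r : ℕ}

/-- The pure binomial `x^a - x^b`. -/
noncomputable def pureBinomial (a b : Fin n →₀ ℕ) : MvPolynomial (Fin n) ℝ :=
  monomial a 1 - monomial b 1

/-- The set defined by `x_i ≥ 0` for all `i` and `g_j(x) ≥ 0` for all `j`. -/
def orthantSet (g : Fin r → MvPolynomial (Fin n) ℝ) : Set (Fin n → ℝ) :=
  {x | (∀ i, 0 ≤ x i) ∧ ∀ j, 0 ≤ eval x (g j)}

/-- The truncated quadratic module `QM_d(g)`: sums of terms `σ_{J,i} x^J g_i`, `J ⊆ [n]`,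
`0 ≤ i ≤ r`, `g_0 = 1`, with `σ_{J,i}` a sum of squares and every term of degree at most `d`. -/
def truncQM (g : Fin r → MvPolynomial (Fin n) ℝ) (d : ℕ) : Set (MvPolynomial (Fin n) ℝ) :=
  {f | ∃ σ : Finset (Fin n) → Fin (r + 1) → MvPolynomial (Fin n) ℝ,
    (∀ J i, IsSumSq (σ J i) ∧
      (σ J i * (∏ j ∈ J, X j) * Matrix.vecCons 1 g i).totalDegree ≤ d) ∧
    f = ∑ J, ∑ i, σ J i * (∏ j ∈ J, X j) * Matrix.vecCons 1 g i}

/-- The truncated preorder `PO_d(g)`: sums of terms `σ_{J,I} x^J g^I`, `J ⊆ [n]`, `I ⊆ [r]`,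
with `σ_{J,I}` a sum of squares and every term of degree at most `d`. -/
def truncPO (g : Fin r → MvPolynomial (Fin n) ℝ) (d : ℕ) : Set (MvPolynomial (Fin n) ℝ) :=
  {f | ∃ σ : Finset (Fin n) → Finset (Fin r) → MvPolynomial (Fin n) ℝ,
    (∀ J I, IsSumSq (σ J I) ∧
      (σ J I * (∏ j ∈ J, X j) * ∏ i ∈ I, g i).totalDegree ≤ d) ∧
    f = ∑ J, ∑ I, σ J I * (∏ j ∈ J, X j) * ∏ i ∈ I, g i}

/-- The dual cone, in `ℝ[x]_d^*`, of a set `C` of polynomials of degree at most `d`. -/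
def dualCone (d : ℕ) (C : Set (MvPolynomial (Fin n) ℝ)) :
    Set (Module.Dual ℝ (restrictTotalDegree (Fin n) ℝ d)) :=
  {ℓ | ∀ f : restrictTotalDegree (Fin n) ℝ d, (f : MvPolynomial (Fin n) ℝ) ∈ C → 0 ≤ ℓ f}

/-- The exponent vectors of the monomials of degree at most `d`. -/
abbrev Exponents (n d : ℕ) : Type := {γ : Fin n →₀ ℕ // γ.degree ≤ d}

/-- The monomial `x^γ` as an element of `ℝ[x]_d`. -/
noncomputable def monomialLE {d : ℕ} (γ : Exponents n d) : restrictTotalDegree (Fin n) ℝ d :=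
  ⟨monomial γ.1 1, (mem_restrictTotalDegree _ _ _).2
    ((totalDegree_monomial_le _ _).trans γ.2)⟩

/-- The coordinates `(ℓ(x^γ))_{|γ| ≤ d}` of `ℓ` in the basis dual to the monomials. -/
noncomputable def moments {d : ℕ} (ℓ : Module.Dual ℝ (restrictTotalDegree (Fin n) ℝ d)) :
    Exponents n d → ℝ :=
  fun γ => ℓ (monomialLE γ)

/-- The tropicalization of the dual cone of `C`, in the coordinates of the dual monomial basis. -/
noncomputable def tropDual (d : ℕ) (C : Set (MvPolynomial (Fin n) ℝ)) :
    Set (Exponents n d → ℝ) :=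
  tropicalization (moments '' dualCone d C)

/-- The coordinate projection onto the exponents in `A`. -/
def proj {d : ℕ} (A : Finset (Fin n →₀ ℕ)) (hA : ∀ γ ∈ A, γ.degree ≤ d)
    (h : Exponents n d → ℝ) : A → ℝ :=
  fun γ => h ⟨γ.1, hA γ.1 γ.2⟩

end TropMoment

namespace TropMoment

open MvPolynomial Filter
open scoped Topology

/-! ### Degrees of sums of squares -/

/-! Both tropicalizations in degree `d` coincide with the polyhedral cone `IsTropicalMoment` of
binomial inequalities: midpoint convexity and monotonicity along each `x^a - x^b`.

A functional that is nonnegative on the quadratic module and has nonzero moments satisfies these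
inequalities multiplicatively; take logarithms and pass to the limit
(`isTropicalMoment_of_mem_tropDual`).

Conversely (`IsTropicalMoment.mem_tropDual`), perturb a point `h` of the cone by `ε` times a
strictly convex quadratic weight whose linear part is steep along every nonzero `a i - b i`. Such a
direction exists because `S` has interior. All nontrivial inequalities become strict, so the moments
`t ^ w γ` satisfy them with a factor `δ = t ^ (-ε)` to spare. For large `t` the Gram matrices of all
terms `x^J g^I` are then diagonally dominated, and the functional is nonnegative on the whole
preorder. Let `ε → 0`.

Inequalities in degree `D ≥ d` include those in degree `d`, so truncating a point loses nothing. -/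

theorem degLex_add_of_leadingCoeff_nonneg {σ : Type*} [LinearOrder σ] [WellFoundedGT σ]
    {p q : MvPolynomial σ ℝ}
    (hp : 0 ≤ MonomialOrder.degLex.leadingCoeff p)
    (hq : 0 ≤ MonomialOrder.degLex.leadingCoeff q) :
    0 ≤ MonomialOrder.degLex.leadingCoeff (p + q) ∧
      p.totalDegree ≤ (p + q).totalDegree ∧ q.totalDegree ≤ (p + q).totalDegree := by
  set m := MonomialOrder.degLex (σ := σ)
  -- Nonnegative leading coefficients cannot cancel. As `degLex` compares total degrees first, it is
  -- enough to compare leading exponents.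
  suffices h : 0 ≤ m.leadingCoeff (p + q) ∧
      m.toSyn (m.degree p) ≤ m.toSyn (m.degree (p + q)) ∧
      m.toSyn (m.degree q) ≤ m.toSyn (m.degree (p + q)) from
    ⟨h.1, degLex_totalDegree_monotone h.2.1, degLex_totalDegree_monotone h.2.2⟩
  rcases eq_or_ne p 0 with rfl | hp0
  · simp [hq]
  rcases eq_or_ne q 0 with rfl | hq0
  · simp [hp]
  have hp' : 0 < m.leadingCoeff p := lt_of_le_of_ne hp (m.leadingCoeff_ne_zero_iff.2 hp0).symm
  have hq' : 0 < m.leadingCoeff q := lt_of_le_of_ne hq (m.leadingCoeff_ne_zero_iff.2 hq0).symm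
  rcases lt_trichotomy (m.toSyn (m.degree p)) (m.toSyn (m.degree q)) with h | h | h
  · rw [m.degree_add_eq_right_of_lt h, add_comm, m.leadingCoeff_add_of_lt h]
    exact ⟨hq, h.le, le_rfl⟩
  · have hd : m.degree p = m.degree q := m.toSyn.injective h
    have hc : (p + q).coeff (m.degree q) = m.leadingCoeff p + m.leadingCoeff q := by
      rw [coeff_add]
      simp only [MonomialOrder.leadingCoeff, hd]
    have hle : m.toSyn (m.degree q) ≤ m.toSyn (m.degree (p + q)) :=
      m.le_degree (by rw [mem_support_iff, hc]; positivity)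
    have hge : m.toSyn (m.degree (p + q)) ≤ m.toSyn (m.degree q) := by
      simpa [h] using m.degree_add_le (f := p) (g := q)
    have he : m.degree (p + q) = m.degree q := m.toSyn.injective (le_antisymm hge hle)
    refine ⟨?_, h ▸ hle, hle⟩
    rw [MonomialOrder.leadingCoeff, he, hc]
    positivity
  · rw [m.degree_add_of_lt h, m.leadingCoeff_add_of_lt h]
    exact ⟨hp, le_rfl, h.le⟩

theorem leadingCoeff_mul_self_nonneg {σ : Type*} [LinearOrder σ] [WellFoundedGT σ]
    (p : MvPolynomial σ ℝ) : 0 ≤ MonomialOrder.degLex.leadingCoeff (p * p) := by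
  rw [MonomialOrder.leadingCoeff_mul]
  exact mul_self_nonneg _

theorem leadingCoeff_nonneg_of_isSumSq {σ : Type*} [LinearOrder σ] [WellFoundedGT σ]
    {s : MvPolynomial σ ℝ} (hs : IsSumSq s) : 0 ≤ MonomialOrder.degLex.leadingCoeff s := by
  induction hs with
  | zero => simp
  | sq_add p _ ih =>
    exact (degLex_add_of_leadingCoeff_nonneg (leadingCoeff_mul_self_nonneg p) ih).1

/-! ### Diagonally dominated quadratic forms -/

/-- With `y i = (c i * u i) ^ 2`, AM-GM bounds the off-diagonal terms by `δ / 2 * (y i + y j)`; what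
remains is at least `(1 / 2 - s.card * δ) * ∑ y i`. -/
theorem sum_mul_mul_nonneg_of_dominated {ι : Type*} [DecidableEq ι] (s : Finset ι) (c u : ι → ℝ)
    (B : ι → ι → ℝ) {δ : ℝ} (hδ : 0 ≤ δ) (hs : s.card * δ ≤ 1 / 2)
    (hdiag : ∀ i ∈ s, u i ^ 2 / 2 ≤ B i i)
    (hoff : ∀ i ∈ s, ∀ j ∈ s, i ≠ j → |B i j| ≤ δ * (u i * u j)) :
    0 ≤ ∑ i ∈ s, ∑ j ∈ s, c i * c j * B i j := by
  set y : ι → ℝ := fun i => (c i * u i) ^ 2 with hy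
  have hy0 : ∀ i, 0 ≤ y i := fun i => sq_nonneg _
  have key : ∀ i ∈ s, ∀ j ∈ s,
      (if i = j then y i / 2 else 0) - δ / 2 * (y i + y j) ≤ c i * c j * B i j := by
    intro i hi j hj
    split_ifs with h
    · subst h
      have h1 : y i / 2 ≤ c i * c i * B i i := by
        have := mul_le_mul_of_nonneg_left (hdiag i hi) (mul_self_nonneg (c i))
        calc y i / 2 = c i * c i * (u i ^ 2 / 2) := by simp only [hy]; ring
          _ ≤ _ := this
      have h2 : 0 ≤ δ / 2 * (y i + y i) := by have := hy0 i; positivity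
      linarith
    · have h1 : |c i * c j * B i j| ≤ |c i * c j| * (δ * (u i * u j)) := by
        rw [abs_mul]
        exact mul_le_mul_of_nonneg_left (hoff i hi j hj h) (abs_nonneg _)
      have h2 : |c i * c j| * (u i * u j) ≤ (y i + y j) / 2 := by
        have h3 : |c i * c j| * (u i * u j) ≤ |(c i * u i) * (c j * u j)| := by
          calc _ ≤ |c i * c j| * |u i * u j| :=
                mul_le_mul_of_nonneg_left (le_abs_self _) (abs_nonneg _)
            _ = _ := by rw [← abs_mul]; congr 1; ring
        refine h3.trans (abs_le.2 ⟨?_, ?_⟩) <;> simp only [hy]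
        · nlinarith [sq_nonneg (c i * u i + c j * u j)]
        · nlinarith [sq_nonneg (c i * u i - c j * u j)]
      have h4 := mul_le_mul_of_nonneg_left h2 hδ
      have h5 := neg_abs_le (c i * c j * B i j)
      linarith
  refine le_trans ?_ (Finset.sum_le_sum fun i hi => Finset.sum_le_sum fun j hj => key i hi j hj)
  have : ∑ i ∈ s, ∑ j ∈ s, ((if i = j then y i / 2 else 0) - δ / 2 * (y i + y j))
      = (1 / 2 - s.card * δ) * ∑ i ∈ s, y i := by
    simp only [Finset.sum_sub_distrib, ← Finset.mul_sum, Finset.sum_add_distrib,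
      Finset.sum_const, Finset.sum_ite_eq, nsmul_eq_mul]
    rw [Finset.sum_congr rfl (fun i hi => if_pos hi), ← Finset.sum_div]
    ring
  rw [this]
  exact mul_nonneg (by linarith) (Finset.sum_nonneg fun i _ => hy0 i)

/-! ### Functionals with prescribed moments -/

variable {n r : ℕ}

/-- The linear functional on polynomials with moments `W`. -/
noncomputable def momentFunctional (W : (Fin n →₀ ℕ) → ℝ) : MvPolynomial (Fin n) ℝ →ₗ[ℝ] ℝ :=
  (basisMonomials (Fin n) ℝ).constr ℝ W

theorem momentFunctional_monomial (W : (Fin n →₀ ℕ) → ℝ) (γ : Fin n →₀ ℕ) :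
    momentFunctional W (monomial γ 1) = W γ := by
  have := (basisMonomials (Fin n) ℝ).constr_basis ℝ W γ
  rwa [coe_basisMonomials] at this

/-- Moments that satisfy, by a factor `δ`, the binomial inequalities of degree at most `d` that
hold on the dual cone of the truncated quadratic module. -/
structure IsStrictMoments (a b : Fin r → Fin n →₀ ℕ) (d : ℕ) (δ : ℝ)
    (W : (Fin n →₀ ℕ) → ℝ) : Prop where
  pos : ∀ γ, 0 < W γ
  shift : ∀ i γ, a i ≠ b i → (γ + a i).degree ≤ d → (γ + b i).degree ≤ d →
    W (γ + b i) ≤ δ * W (γ + a i)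
  mid : ∀ γ α β : Fin n →₀ ℕ, α ≠ β → (γ + 2 • α).degree ≤ d → (γ + 2 • β).degree ≤ d →
    W (γ + α + β) ^ 2 ≤ δ ^ 2 * (W (γ + 2 • α) * W (γ + 2 • β))

/-- Expanding one binomial at a time, the `b i` branch is at most `δ` times the leading moment. The
two bounds are proved together: each one for the product uses the opposite one for the `b i` branch.
-/
theorem IsStrictMoments.bounds_prod {a b : Fin r → Fin n →₀ ℕ} {d : ℕ} {δ : ℝ}
    {W : (Fin n →₀ ℕ) → ℝ} (hW : IsStrictMoments a b d δ W) (hδ : 0 ≤ δ)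
    (I : Finset (Fin r)) (hI : ∀ i ∈ I, a i ≠ b i) (hcard : I.card * δ ≤ 1)
    (γ : Fin n →₀ ℕ) (hγ : γ.degree + ∑ i ∈ I, max (a i).degree (b i).degree ≤ d) :
    (1 - I.card * δ) * W (γ + ∑ i ∈ I, a i) ≤
        momentFunctional W (monomial γ 1 * ∏ i ∈ I, pureBinomial (a i) (b i)) ∧
      momentFunctional W (monomial γ 1 * ∏ i ∈ I, pureBinomial (a i) (b i)) ≤
        W (γ + ∑ i ∈ I, a i) := by
  induction I using Finset.induction_on generalizing γ with
  | empty => simp [momentFunctional_monomial]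
  | insert i I hi ih =>
    rw [Finset.card_insert_of_notMem hi] at hcard ⊢
    push_cast at hcard ⊢
    rw [Finset.sum_insert hi] at hγ
    have hI' : ∀ k ∈ I, a k ≠ b k := fun k hk => hI k (Finset.mem_insert_of_mem hk)
    have hc : (I.card : ℝ) * δ ≤ 1 := by linarith
    have ha := ih hI' hc (γ + a i) (by rw [map_add]; omega)
    have hb := ih hI' hc (γ + b i) (by rw [map_add]; omega)
    have hsum : (∑ k ∈ I, a k).degree ≤ ∑ k ∈ I, max (a k).degree (b k).degree := by
      rw [map_sum]
      exact Finset.sum_le_sum fun k _ => le_max_left _ _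
    have hs := hW.shift i (γ + ∑ k ∈ I, a k) (hI i (Finset.mem_insert_self _ _))
      (by simp only [map_add]; omega) (by simp only [map_add]; omega)
    have hexp : monomial γ (1 : ℝ) * ∏ k ∈ insert i I, pureBinomial (a k) (b k) =
        monomial (γ + a i) 1 * ∏ k ∈ I, pureBinomial (a k) (b k) -
          monomial (γ + b i) 1 * ∏ k ∈ I, pureBinomial (a k) (b k) := by
      rw [Finset.prod_insert hi, pureBinomial, ← mul_assoc, mul_sub, monomial_mul, monomial_mul,
        sub_mul, one_mul]
    rw [hexp, map_sub, Finset.sum_insert hi, ← add_assoc]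
    rw [add_right_comm γ _ (b i), add_right_comm γ _ (a i)] at hs
    have hb0 : 0 ≤ (1 - I.card * δ) * W (γ + b i + ∑ k ∈ I, a k) :=
      mul_nonneg (by linarith) (hW.pos _).le
    constructor
    · have := ha.1
      have := hb.2
      linarith
    · linarith [ha.2, hb.1]

theorem prod_X_eq_monomial (J : Finset (Fin n)) :
    (∏ j ∈ J, X j : MvPolynomial (Fin n) ℝ) = monomial (∑ j ∈ J, Finsupp.single j 1) 1 := by
  rw [monomial_sum_one]
  rfl

/-- The exponents of degree at most `d`, as a finite set. -/
noncomputable def exponentsLE (n d : ℕ) : Finset (Fin n →₀ ℕ) :=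
  (Finsupp.finite_of_degree_le d).toFinset

theorem mem_exponentsLE {d : ℕ} {γ : Fin n →₀ ℕ} : γ ∈ exponentsLE n d ↔ γ.degree ≤ d := by
  simp [exponentsLE]

theorem momentFunctional_mul_self_mul (W : (Fin n →₀ ℕ) → ℝ) (q p : MvPolynomial (Fin n) ℝ)
    (γ : Fin n →₀ ℕ) :
    momentFunctional W (q * q * monomial γ 1 * p) =
      ∑ α ∈ q.support, ∑ β ∈ q.support, q.coeff α * q.coeff β *
        momentFunctional W (monomial (γ + α + β) 1 * p) := by
  have h : q * q * monomial γ 1 * p = ∑ α ∈ q.support, ∑ β ∈ q.support,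
      (q.coeff α * q.coeff β) • (monomial (γ + α + β) 1 * p) := by
    have h1 : q * q = ∑ α ∈ q.support, ∑ β ∈ q.support,
        monomial α (q.coeff α) * monomial β (q.coeff β) := by
      rw [← Finset.sum_mul_sum, ← q.as_sum]
    rw [h1]
    simp only [Finset.sum_mul]
    refine Finset.sum_congr rfl fun α _ => Finset.sum_congr rfl fun β _ => ?_
    rw [monomial_mul, monomial_mul, ← smul_mul_assoc, smul_monomial]
    rw [show α + β + γ = γ + α + β by abel]
    simp
  rw [h]
  simp only [map_sum, map_smul, smul_eq_mul]

/-- Up to a factor in `[1/2, 1]`, the Gram matrix has entries `W (γ + κ + α + β)`; by `mid` an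
off-diagonal one is at most `δ` times the geometric mean of the corresponding diagonal moments. -/
theorem IsStrictMoments.mul_self_nonneg {a b : Fin r → Fin n →₀ ℕ} {d : ℕ} {δ : ℝ}
    {W : (Fin n →₀ ℕ) → ℝ} (hW : IsStrictMoments a b d δ W) (hδ : 0 ≤ δ)
    (hr : r * δ ≤ 1 / 2) (hN : (exponentsLE n d).card * δ ≤ 1 / 2)
    (I : Finset (Fin r)) (hI : ∀ i ∈ I, a i ≠ b i)
    (γ : Fin n →₀ ℕ) (q : MvPolynomial (Fin n) ℝ)
    (hq : 2 * q.totalDegree + γ.degree + ∑ i ∈ I, max (a i).degree (b i).degree ≤ d) :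
    0 ≤ momentFunctional W (q * q * monomial γ 1 * ∏ i ∈ I, pureBinomial (a i) (b i)) := by
  classical
  rw [momentFunctional_mul_self_mul]
  set P := ∏ i ∈ I, pureBinomial (a i) (b i)
  set κ := ∑ i ∈ I, a i with hκ
  have hIr : (I.card : ℝ) * δ ≤ 1 / 2 := by
    refine le_trans (mul_le_mul_of_nonneg_right ?_ hδ) hr
    exact_mod_cast (Finset.card_le_univ I).trans (by simp)
  have hdeg : ∀ α ∈ q.support, α.degree ≤ q.totalDegree := fun α hα => le_totalDegree hα
  have hκd : κ.degree ≤ ∑ i ∈ I, max (a i).degree (b i).degree := by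
    rw [hκ, map_sum]
    exact Finset.sum_le_sum fun k _ => le_max_left _ _
  have hB : ∀ α ∈ q.support, ∀ β ∈ q.support,
      (1 - I.card * δ) * W (γ + κ + α + β) ≤
        momentFunctional W (monomial (γ + α + β) 1 * P) ∧
      momentFunctional W (monomial (γ + α + β) 1 * P) ≤ W (γ + κ + α + β) := by
    intro α hα β hβ
    have h := hW.bounds_prod hδ I hI (by linarith) (γ + α + β) (by
      have := hdeg α hα
      have := hdeg β hβ
      simp only [map_add]
      omega)
    have he : γ + α + β + κ = γ + κ + α + β := by abel
    rwa [← hκ, he] at h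
  have hcard : (q.support.card : ℝ) * δ ≤ 1 / 2 := by
    refine le_trans (mul_le_mul_of_nonneg_right ?_ hδ) hN
    exact_mod_cast Finset.card_le_card fun α hα =>
      mem_exponentsLE.2 (by have := hdeg α hα; omega)
  refine sum_mul_mul_nonneg_of_dominated q.support q.coeff (fun α => √(W (γ + κ + 2 • α)))
    (fun α β => momentFunctional W (monomial (γ + α + β) 1 * P)) hδ hcard ?_ ?_
  · intro α hα
    have h := (hB α hα α hα).1
    have h0 := hW.pos (γ + κ + 2 • α)
    rw [Real.sq_sqrt h0.le]
    rw [add_assoc (γ + κ), ← two_nsmul] at h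
    refine le_trans ?_ h
    rw [div_eq_inv_mul]
    exact mul_le_mul_of_nonneg_right (by norm_num; linarith) h0.le
  · intro α hα β hβ hne
    have h := hB α hα β hβ
    have h0 : 0 ≤ (1 - I.card * δ) * W (γ + κ + α + β) :=
      mul_nonneg (by linarith) (hW.pos _).le
    rw [abs_of_nonneg (h0.trans h.1)]
    refine h.2.trans ?_
    have hα' := hdeg α hα
    have hβ' := hdeg β hβ
    have hm := hW.mid (γ + κ) α β hne (by simp only [map_add, map_nsmul, smul_eq_mul]; omega)
      (by simp only [map_add, map_nsmul, smul_eq_mul]; omega)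
    refine (pow_le_pow_iff_left₀ (hW.pos _).le (by positivity) two_ne_zero).1 ?_
    rwa [mul_pow, mul_pow, Real.sq_sqrt (hW.pos _).le, Real.sq_sqrt (hW.pos _).le]

theorem mem_support_pureBinomial {a b : Fin n →₀ ℕ} (h : a ≠ b) :
    a ∈ (pureBinomial a b).support ∧ b ∈ (pureBinomial a b).support := by
  simp [pureBinomial, mem_support_iff, coeff_monomial, h, h.symm]

theorem pureBinomial_ne_zero_iff {a b : Fin n →₀ ℕ} : pureBinomial a b ≠ 0 ↔ a ≠ b := by
  refine ⟨fun h => ?_, fun h h0 => ?_⟩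
  · rintro rfl
    simp [pureBinomial] at h
  · simpa [h0] using (mem_support_pureBinomial h).1

theorem max_degree_le_totalDegree_pureBinomial {a b : Fin n →₀ ℕ} (h : a ≠ b) :
    max a.degree b.degree ≤ (pureBinomial a b).totalDegree := by
  have := mem_support_pureBinomial h
  exact max_le (le_totalDegree this.1)
    (le_totalDegree this.2)

theorem sum_max_degree_le_totalDegree_prod (a b : Fin r → Fin n →₀ ℕ) (I : Finset (Fin r))
    (hI : ∀ i ∈ I, a i ≠ b i) :
    ∑ i ∈ I, max (a i).degree (b i).degree ≤
      (∏ i ∈ I, pureBinomial (a i) (b i)).totalDegree := by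
  induction I using Finset.induction_on with
  | empty => simp
  | insert i I hi ih =>
    have hI' : ∀ k ∈ I, a k ≠ b k := fun k hk => hI k (Finset.mem_insert_of_mem hk)
    have hai := hI i (Finset.mem_insert_self _ _)
    rw [Finset.sum_insert hi, Finset.prod_insert hi, totalDegree_mul_of_isDomain
      (pureBinomial_ne_zero_iff.2 hai)
      (Finset.prod_ne_zero_iff.2 fun k hk => pureBinomial_ne_zero_iff.2 (hI' k hk))]
    exact add_le_add (max_degree_le_totalDegree_pureBinomial hai) (ih hI')

/-- Degrees add over a domain and top terms of squares do not cancel, so the degree bound on the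
term passes to each single square. -/
theorem IsStrictMoments.sumSq_nonneg {a b : Fin r → Fin n →₀ ℕ} {d : ℕ} {δ : ℝ}
    {W : (Fin n →₀ ℕ) → ℝ} (hW : IsStrictMoments a b d δ W) (hδ : 0 ≤ δ)
    (hr : r * δ ≤ 1 / 2) (hN : (exponentsLE n d).card * δ ≤ 1 / 2)
    (J : Finset (Fin n)) (I : Finset (Fin r)) {s : MvPolynomial (Fin n) ℝ} (hs : IsSumSq s)
    (hd : (s * (∏ j ∈ J, X j) * ∏ i ∈ I, pureBinomial (a i) (b i)).totalDegree ≤ d) :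
    0 ≤ momentFunctional W (s * (∏ j ∈ J, X j) * ∏ i ∈ I, pureBinomial (a i) (b i)) := by
  by_cases hI : ∀ i ∈ I, a i ≠ b i
  swap
  · push Not at hI
    obtain ⟨i, hi, h⟩ := hI
    rw [Finset.prod_eq_zero hi (by simp [pureBinomial, h])]
    simp
  rcases eq_or_ne s 0 with rfl | hs0
  · simp
  rw [prod_X_eq_monomial] at hd ⊢
  set γ := ∑ j ∈ J, Finsupp.single j 1
  set P := ∏ i ∈ I, pureBinomial (a i) (b i)
  have hP0 : P ≠ 0 := Finset.prod_ne_zero_iff.2 fun k hk => pureBinomial_ne_zero_iff.2 (hI k hk)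
  have hγ0 : monomial γ (1 : ℝ) ≠ 0 := by simp
  rw [totalDegree_mul_of_isDomain (mul_ne_zero hs0 hγ0) hP0, totalDegree_mul_of_isDomain hs0 hγ0,
    totalDegree_monomial _ one_ne_zero] at hd
  have hPd := sum_max_degree_le_totalDegree_prod a b I hI
  have hd' : s.totalDegree + γ.degree + ∑ i ∈ I, max (a i).degree (b i).degree ≤ d := by
    refine le_trans (add_le_add_right hPd _) ?_
    exact hd
  clear hd hs0
  induction hs with
  | zero => simp
  | sq_add p hs ih =>
    obtain ⟨-, h1, h2⟩ := degLex_add_of_leadingCoeff_nonneg (leadingCoeff_mul_self_nonneg p)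
      (leadingCoeff_nonneg_of_isSumSq hs)
    have hp : (p * p).totalDegree = 2 * p.totalDegree := by
      rcases eq_or_ne p 0 with rfl | hp0
      · simp
      · rw [totalDegree_mul_of_isDomain hp0 hp0, two_mul]
    rw [add_mul, add_mul, map_add]
    exact add_nonneg (hW.mul_self_nonneg hδ hr hN I hI γ p (by omega)) (ih (by omega))

theorem IsStrictMoments.nonneg_of_mem_truncPO {a b : Fin r → Fin n →₀ ℕ} {d : ℕ} {δ : ℝ}
    {W : (Fin n →₀ ℕ) → ℝ} (hW : IsStrictMoments a b d δ W) (hδ : 0 ≤ δ)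
    (hr : r * δ ≤ 1 / 2) (hN : (exponentsLE n d).card * δ ≤ 1 / 2)
    {f : MvPolynomial (Fin n) ℝ}
    (hf : f ∈ truncPO (fun i => pureBinomial (a i) (b i)) d) : 0 ≤ momentFunctional W f := by
  obtain ⟨σ, hσ, rfl⟩ := hf
  simp only [map_sum]
  exact Finset.sum_nonneg fun J _ => Finset.sum_nonneg fun I _ =>
    hW.sumSq_nonneg hδ hr hN J I (hσ J I).1 (hσ J I).2

/-! ### Binomial inequalities on the dual cones -/

/-- The polyhedral cone of the tropical binomial inequalities in degree at most `d`: midpoint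
convexity, and monotonicity along the binomials `x^a - x^b`. -/
structure IsTropicalMoment (a b : Fin r → Fin n →₀ ℕ) (d : ℕ) (h : Exponents n d → ℝ) : Prop where
  shift : ∀ i γ (h₁ : (γ + a i).degree ≤ d) (h₂ : (γ + b i).degree ≤ d),
    h ⟨γ + b i, h₂⟩ ≤ h ⟨γ + a i, h₁⟩
  mid : ∀ (γ α β : Fin n →₀ ℕ) (h₁ : (γ + 2 • α).degree ≤ d) (h₂ : (γ + 2 • β).degree ≤ d)
    (h₃ : (γ + α + β).degree ≤ d),
    2 * h ⟨γ + α + β, h₃⟩ ≤ h ⟨γ + 2 • α, h₁⟩ + h ⟨γ + 2 • β, h₂⟩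

theorem isClosed_isTropicalMoment (a b : Fin r → Fin n →₀ ℕ) (d : ℕ) :
    IsClosed {h : Exponents n d → ℝ | IsTropicalMoment a b d h} := by
  have : {h : Exponents n d → ℝ | IsTropicalMoment a b d h} =
      {h | ∀ i γ (h₁ : (γ + a i).degree ≤ d) (h₂ : (γ + b i).degree ≤ d),
        h ⟨γ + b i, h₂⟩ ≤ h ⟨γ + a i, h₁⟩} ∩
      {h | ∀ (γ α β : Fin n →₀ ℕ) (h₁ : (γ + 2 • α).degree ≤ d) (h₂ : (γ + 2 • β).degree ≤ d)
        (h₃ : (γ + α + β).degree ≤ d),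
        2 * h ⟨γ + α + β, h₃⟩ ≤ h ⟨γ + 2 • α, h₁⟩ + h ⟨γ + 2 • β, h₂⟩} := by
    ext h
    exact ⟨fun H => ⟨H.1, H.2⟩, fun H => ⟨H.1, H.2⟩⟩
  rw [this]
  refine IsClosed.inter ?_ ?_
  · simp only [Set.ofPred_forall]
    exact isClosed_iInter fun _ => isClosed_iInter fun _ => isClosed_iInter fun _ =>
      isClosed_iInter fun _ => isClosed_le (by fun_prop) (by fun_prop)
  · simp only [Set.ofPred_forall]
    exact isClosed_iInter fun _ => isClosed_iInter fun _ => isClosed_iInter fun _ =>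
      isClosed_iInter fun _ => isClosed_iInter fun _ => isClosed_iInter fun _ =>
      isClosed_le (by fun_prop) (by fun_prop)

theorem tropicalization_subset_of_isClosed {ι : Type*} {S F : Set (ι → ℝ)} (hF : IsClosed F)
    (h : ∀ t : ℝ, 1 < t → ∀ x ∈ S, (∀ i, x i ≠ 0) → (fun i => Real.logb t |x i|) ∈ F) :
    tropicalization S ⊆ F := by
  intro y hy
  by_contra hyF
  obtain ⟨t, ⟨x, hx, hx0, hxF⟩, ht⟩ :=
    ((hy Fᶜ (hF.isOpen_compl.mem_nhds hyF)).and_eventually (eventually_gt_atTop 1)).exists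
  exact hxF (h t ht x hx hx0)

theorem tropicalization_mono {ι : Type*} {S T : Set (ι → ℝ)} (h : S ⊆ T) :
    tropicalization S ⊆ tropicalization T := fun _ hy U hU =>
  (hy U hU).mono fun _ ⟨x, hx, H⟩ => ⟨x, h hx, H⟩

theorem tropDual_anti (d : ℕ) {C C' : Set (MvPolynomial (Fin n) ℝ)} (h : C ⊆ C') :
    tropDual d C' ⊆ tropDual d C :=
  tropicalization_mono (Set.image_mono fun _ hℓ f hf => hℓ f (h hf))

theorem truncQM_subset_truncPO (g : Fin r → MvPolynomial (Fin n) ℝ) (d : ℕ) :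
    truncQM g d ⊆ truncPO g d := by
  classical
  rintro f ⟨σ, hσ, rfl⟩
  let φ : Fin (r + 1) → Finset (Fin r) := Fin.cases ∅ fun i => {i}
  have hφ : Function.Injective φ := by
    intro i j
    refine Fin.cases ?_ (fun i => ?_) i <;> refine Fin.cases ?_ (fun j => ?_) j <;> simp [φ]
  have hprod : ∀ i, ∏ k ∈ φ i, g k = Matrix.vecCons 1 g i := by
    intro i
    refine Fin.cases ?_ (fun i => ?_) i <;> simp [φ]
  -- Products of two or more binomials get multiplier `0`; injectivity of `φ` makes `choose` recover
  -- the index.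
  refine ⟨fun J I => if h : ∃ i, φ i = I then σ J h.choose else 0, fun J I => ?_, ?_⟩
  · by_cases h : ∃ i, φ i = I
    · have h' := hprod h.choose
      rw [h.choose_spec] at h'
      simp only [dif_pos h, h']
      exact hσ J _
    · simp [dif_neg h]
  · refine Finset.sum_congr rfl fun J _ => ?_
    refine Finset.sum_of_injOn φ hφ.injOn (fun _ _ => Finset.mem_coe.2 (Finset.mem_univ _))
      ?_ fun i _ => ?_
    · intro I _ hI
      have : ¬ ∃ i, φ i = I := by simpa using hI
      simp [dif_neg this]
    · have h : ∃ k, φ k = φ i := ⟨i, rfl⟩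
      have : h.choose = i := hφ h.choose_spec
      simp only [dif_pos h, this, hprod]

theorem mem_truncQM_of_isSumSq (g : Fin r → MvPolynomial (Fin n) ℝ) (d : ℕ)
    {s : MvPolynomial (Fin n) ℝ} (hs : IsSumSq s) (J : Finset (Fin n)) (i : Fin (r + 1))
    (hd : (s * (∏ j ∈ J, X j) * Matrix.vecCons 1 g i).totalDegree ≤ d) :
    s * (∏ j ∈ J, X j) * Matrix.vecCons 1 g i ∈ truncQM g d := by
  classical
  refine ⟨fun J' i' => if J' = J ∧ i' = i then s else 0, fun J' i' => ?_, ?_⟩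
  · by_cases h : J' = J ∧ i' = i
    · obtain ⟨rfl, rfl⟩ := h
      simpa using ⟨hs, hd⟩
    · simp [if_neg h]
  · rw [Finset.sum_eq_single J, Finset.sum_eq_single i]
    · simp
    · intro i' _ h
      simp [h]
    · simp
    · intro J' _ h
      simp [h]
    · simp

/-- Split off the odd exponents: every monomial is a square times some `x^J`, hence an admissible
multiplier in the quadratic module. -/
theorem exists_eq_sum_single_add_two_nsmul (γ : Fin n →₀ ℕ) :
    ∃ (J : Finset (Fin n)) (κ : Fin n →₀ ℕ), γ = ∑ j ∈ J, Finsupp.single j 1 + 2 • κ := by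
  classical
  refine ⟨Finset.univ.filter fun j => γ j % 2 = 1,
    Finsupp.equivFunOnFinite.symm fun j => γ j / 2, ?_⟩
  ext j
  simp only [Finsupp.add_apply, Finsupp.finsetSum_apply, Finsupp.single_apply, Finsupp.smul_apply,
    Finset.sum_ite_eq', Finset.mem_filter, Finset.mem_univ, true_and, smul_eq_mul,
    Finsupp.equivFunOnFinite_symm_apply_apply]
  split_ifs <;> omega

theorem isTropicalMoment_logb {a b : Fin r → Fin n →₀ ℕ} {d : ℕ} {t : ℝ} (ht : 1 < t)
    {ℓ : Module.Dual ℝ (restrictTotalDegree (Fin n) ℝ d)}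
    (hℓ : ℓ ∈ dualCone d (truncQM (fun i => pureBinomial (a i) (b i)) d))
    (hne : ∀ γ, moments ℓ γ ≠ 0) :
    IsTropicalMoment a b d fun γ => Real.logb t |moments ℓ γ| := by
  obtain ⟨L, hL⟩ := LinearMap.exists_extend ℓ
  have hm : ∀ γ, moments ℓ γ = L (monomial γ.1 1) := fun γ => by
    simp [moments, ← hL, monomialLE]
  have hterm : ∀ (q : MvPolynomial (Fin n) ℝ) (J : Finset (Fin n)) (i : Fin (r + 1)),
      (q * q * (∏ j ∈ J, X j) *
        Matrix.vecCons 1 (fun i => pureBinomial (a i) (b i)) i).totalDegree ≤ d →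
      0 ≤ L (q * q * (∏ j ∈ J, X j) *
        Matrix.vecCons 1 (fun i => pureBinomial (a i) (b i)) i) := by
    intro q J i hd
    have := hℓ ⟨_, (mem_restrictTotalDegree _ _ _).2 hd⟩
      (mem_truncQM_of_isSumSq _ d (IsSumSq.mul_self q) J i hd)
    simpa [← hL] using this
  -- Each monomial lies in the quadratic module; `hne` upgrades nonnegativity to positivity.
  have hpos : ∀ γ : Fin n →₀ ℕ, γ.degree ≤ d → 0 < L (monomial γ 1) := by
    intro γ hγ
    refine lt_of_le_of_ne ?_ (by simpa [hm] using (hne ⟨γ, hγ⟩).symm)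
    obtain ⟨J, κ, hJ⟩ := exists_eq_sum_single_add_two_nsmul γ
    have he : monomial κ 1 * monomial κ 1 * (∏ j ∈ J, X j) *
        Matrix.vecCons 1 (fun i => pureBinomial (a i) (b i)) 0 = monomial γ (1 : ℝ) := by
      rw [prod_X_eq_monomial, Matrix.cons_val_zero, mul_one, monomial_mul, monomial_mul, hJ,
        two_nsmul, add_comm (κ + κ)]
      simp
    have := hterm (monomial κ 1) J 0
    rw [he] at this
    exact this ((totalDegree_monomial_le _ _).trans hγ)
  constructor
  · intro i γ h₁ h₂
    simp only [hm, abs_of_pos (hpos _ h₁), abs_of_pos (hpos _ h₂)]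
    refine Real.logb_le_logb_of_le ht (hpos _ h₂) ?_
    obtain ⟨J, κ, hJ⟩ := exists_eq_sum_single_add_two_nsmul γ
    have he : monomial κ 1 * monomial κ 1 * (∏ j ∈ J, X j) *
        Matrix.vecCons 1 (fun i => pureBinomial (a i) (b i)) i.succ =
          monomial (γ + a i) (1 : ℝ) - monomial (γ + b i) 1 := by
      rw [prod_X_eq_monomial, Matrix.cons_val_succ, pureBinomial, mul_sub]
      simp only [monomial_mul, hJ, two_nsmul, mul_one, add_comm (κ + κ)]
    have := hterm (monomial κ 1) J i.succ
    rw [he, map_sub, sub_nonneg] at this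
    exact this ((totalDegree_sub _ _).trans (max_le ((totalDegree_monomial_le _ _).trans h₁)
      ((totalDegree_monomial_le _ _).trans h₂)))
  · intro γ α β h₁ h₂ h₃
    simp only [hm, abs_of_pos (hpos _ h₁), abs_of_pos (hpos _ h₂), abs_of_pos (hpos _ h₃)]
    set A := L (monomial (γ + 2 • α) 1) with hA
    set B := L (monomial (γ + α + β) 1) with hB
    set C := L (monomial (γ + 2 • β) 1) with hC
    obtain ⟨J, κ, hJ⟩ := exists_eq_sum_single_add_two_nsmul γ
    -- Test on `x^J (s x^(κ+α) + x^(κ+β))^2`; the discriminant in `s` gives `B ^ 2 ≤ A * C`.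
    have hquad : ∀ s : ℝ, 0 ≤ A * (s * s) + 2 * B * s + C := by
      intro s
      have he : (monomial (κ + α) s + monomial (κ + β) 1) *
          (monomial (κ + α) s + monomial (κ + β) 1) * (∏ j ∈ J, X j) *
          Matrix.vecCons 1 (fun i => pureBinomial (a i) (b i)) 0 =
          (s * s) • monomial (γ + 2 • α) (1 : ℝ) + (2 * s) • monomial (γ + α + β) 1 +
            monomial (γ + 2 • β) 1 := by
        rw [prod_X_eq_monomial, Matrix.cons_val_zero, mul_one, hJ]
        set e := ∑ j ∈ J, Finsupp.single j 1
        simp only [add_mul, mul_add, monomial_mul, smul_monomial, mul_one, one_mul, smul_eq_mul]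
        rw [show κ + α + (κ + α) + e = e + 2 • κ + 2 • α by abel,
          show κ + β + (κ + α) + e = e + 2 • κ + α + β by abel,
          show κ + α + (κ + β) + e = e + 2 • κ + α + β by abel,
          show κ + β + (κ + β) + e = e + 2 • κ + 2 • β by abel, two_mul, map_add]
        abel
      have := hterm (monomial (κ + α) s + monomial (κ + β) 1) J 0
      rw [he] at this
      have h0 := this (by
        refine (totalDegree_add _ _).trans (max_le ((totalDegree_add _ _).trans (max_le ?_ ?_)) ?_)
        · exact (totalDegree_smul_le _ _).trans ((totalDegree_monomial_le _ _).trans h₁)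
        · exact (totalDegree_smul_le _ _).trans ((totalDegree_monomial_le _ _).trans h₃)
        · exact (totalDegree_monomial_le _ _).trans h₂)
      simp only [map_add, map_smul, smul_eq_mul, ← hA, ← hB, ← hC] at h0
      linarith
    have hdisc := discrim_le_zero hquad
    have hle : B ^ 2 ≤ A * C := by
      rw [discrim] at hdisc
      linarith
    have hA0 : 0 < A := hpos _ h₁
    have hB0 : 0 < B := hpos _ h₃
    have hC0 : 0 < C := hpos _ h₂
    have hlog := Real.logb_le_logb_of_le ht (by positivity) hle
    rwa [Real.logb_pow, Real.logb_mul hA0.ne' hC0.ne', Nat.cast_ofNat] at hlog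

theorem isTropicalMoment_of_mem_tropDual {a b : Fin r → Fin n →₀ ℕ} {d : ℕ}
    {h : Exponents n d → ℝ}
    (hh : h ∈ tropDual d (truncQM (fun i => pureBinomial (a i) (b i)) d)) :
    IsTropicalMoment a b d h := by
  refine tropicalization_subset_of_isClosed (isClosed_isTropicalMoment a b d) ?_ hh
  rintro t ht _ ⟨ℓ, hℓ, rfl⟩ hne
  exact isTropicalMoment_logb ht hℓ hne

theorem IsTropicalMoment.restrict {a b : Fin r → Fin n →₀ ℕ} {d D : ℕ} (hdD : d ≤ D)
    {h : Exponents n D → ℝ} (hh : IsTropicalMoment a b D h) :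
    IsTropicalMoment a b d fun γ => h ⟨γ.1, γ.2.trans hdD⟩ :=
  ⟨fun i γ _ _ => hh.shift i γ _ _, fun γ α β _ _ _ => hh.mid γ α β _ _ _⟩

/-! ### Full-dimensionality -/

theorem eval_pureBinomial (a b : Fin n →₀ ℕ) (x : Fin n → ℝ) :
    eval x (pureBinomial a b) = ∏ j, x j ^ a j - ∏ j, x j ^ b j := by
  simp [pureBinomial, eval_monomial, Finsupp.prod_fintype]

/-- In logarithmic coordinates `g_i ≥ 0` is a linear inequality. It still holds after a small move
of an interior point against `a i - b i`, so it is strict at that point. -/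
theorem exists_forall_sum_mul_sub_pos {a b : Fin r → Fin n →₀ ℕ}
    (hS : (interior (orthantSet fun i => pureBinomial (a i) (b i))).Nonempty) :
    ∃ u : Fin n → ℝ, ∀ i, a i ≠ b i → 0 < ∑ j, u j * ((a i j : ℝ) - b i j) := by
  obtain ⟨x, hx⟩ := hS
  set S := orthantSet fun i => pureBinomial (a i) (b i)
  have hx0 : ∀ j, 0 ≤ x j := (interior_subset hx).1
  -- Make all coordinates positive, so that logarithms can be taken.
  have hshift : ∀ᶠ s : ℝ in 𝓝[>] 0, (fun j => x j + s) ∈ interior S := by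
    have hc : Continuous fun s : ℝ => fun j => x j + s := by fun_prop
    have := hc.tendsto 0
    simp only [add_zero] at this
    exact (this.mono_left nhdsWithin_le_nhds).eventually (isOpen_interior.mem_nhds hx)
  obtain ⟨s, hs, hs0⟩ := (hshift.and self_mem_nhdsWithin).exists
  have hs0 : 0 < s := hs0
  set u : Fin n → ℝ := fun j => Real.log (x j + s)
  have hu : ∀ j, Real.exp (u j) = x j + s := fun j => Real.exp_log (by linarith [hx0 j])
  refine ⟨u, fun i hi => ?_⟩
  have hev : ∀ᶠ ε : ℝ in 𝓝[>] 0,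
      (fun j => Real.exp (u j - ε * ((a i j : ℝ) - b i j))) ∈ interior S := by
    have hc : Continuous fun ε : ℝ => fun j => Real.exp (u j - ε * ((a i j : ℝ) - b i j)) := by
      fun_prop
    have := hc.tendsto 0
    simp only [zero_mul, sub_zero, hu] at this
    exact (this.mono_left nhdsWithin_le_nhds).eventually (isOpen_interior.mem_nhds hs)
  obtain ⟨ε, hε, hε0⟩ := (hev.and self_mem_nhdsWithin).exists
  have hε0 : 0 < ε := hε0
  have hge := (interior_subset hε).2 i
  rw [eval_pureBinomial, sub_nonneg] at hge
  simp only [← Real.exp_nat_mul, ← Real.exp_sum, Real.exp_le_exp] at hge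
  have hsq : 0 < ∑ j, ((a i j : ℝ) - b i j) ^ 2 := by
    obtain ⟨j, hj⟩ := Finsupp.ne_iff.1 hi
    refine Finset.sum_pos' (fun _ _ => sq_nonneg _) ⟨j, Finset.mem_univ _, ?_⟩
    have : (a i j : ℝ) - b i j ≠ 0 := sub_ne_zero.2 (by exact_mod_cast hj)
    positivity
  have hid : ∑ j, u j * ((a i j : ℝ) - b i j) =
      (∑ j, (a i j : ℝ) * (u j - ε * ((a i j : ℝ) - b i j)) -
        ∑ j, (b i j : ℝ) * (u j - ε * ((a i j : ℝ) - b i j))) +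
      ε * ∑ j, ((a i j : ℝ) - b i j) ^ 2 := by
    rw [Finset.mul_sum, ← Finset.sum_sub_distrib, ← Finset.sum_add_distrib]
    exact Finset.sum_congr rfl fun j _ => by ring
  rw [hid]
  have := mul_pos hε0 hsq
  linarith

theorem exists_forall_le_sum_mul_sub {a b : Fin r → Fin n →₀ ℕ}
    (hS : (interior (orthantSet fun i => pureBinomial (a i) (b i))).Nonempty) (M : ℝ) :
    ∃ v : Fin n → ℝ, ∀ i, a i ≠ b i → M ≤ ∑ j, v j * ((a i j : ℝ) - b i j) := by
  obtain ⟨u, hu⟩ := exists_forall_sum_mul_sub_pos hS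
  have hev : ∀ᶠ c : ℝ in atTop,
      ∀ i, a i ≠ b i → M ≤ c * ∑ j, u j * ((a i j : ℝ) - b i j) := by
    rw [eventually_all]
    intro i
    by_cases hi : a i = b i
    · simp [hi]
    · filter_upwards [(tendsto_id.atTop_mul_const (hu i hi)).eventually_ge_atTop M] with c hc _
      exact hc
  obtain ⟨c, hc⟩ := hev.exists
  refine ⟨fun j => c * u j, fun i hi => ?_⟩
  simpa only [mul_assoc, ← Finset.mul_sum] using hc i hi

/-- A strictly convex quadratic weight on exponents, with linear part `v`. -/
def quadraticWeight (v : Fin n → ℝ) (γ : Fin n →₀ ℕ) : ℝ :=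
  ∑ j, ((γ j : ℝ) ^ 2 + v j * γ j)

/-- The convexity gap is exactly `2 * ‖α - β‖²` in the Euclidean norm, and distinct integer vectors
are at distance at least `1`. -/
theorem quadraticWeight_mid (v : Fin n → ℝ) (γ : Fin n →₀ ℕ) {α β : Fin n →₀ ℕ} (h : α ≠ β) :
    2 * quadraticWeight v (γ + α + β) + 2 ≤
      quadraticWeight v (γ + 2 • α) + quadraticWeight v (γ + 2 • β) := by
  have hid : quadraticWeight v (γ + 2 • α) + quadraticWeight v (γ + 2 • β) =
      2 * quadraticWeight v (γ + α + β) + 2 * ∑ j, ((α j : ℝ) - β j) ^ 2 := by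
    simp only [quadraticWeight, Finset.mul_sum, ← Finset.sum_add_distrib]
    refine Finset.sum_congr rfl fun j _ => ?_
    simp only [Finsupp.add_apply, Finsupp.smul_apply, smul_eq_mul]
    push_cast
    ring
  have hone : (1 : ℝ) ≤ ∑ j, ((α j : ℝ) - β j) ^ 2 := by
    obtain ⟨j, hj⟩ := Finsupp.ne_iff.1 h
    refine le_trans ?_ (Finset.single_le_sum (f := fun j => ((α j : ℝ) - β j) ^ 2)
      (fun _ _ => sq_nonneg _) (Finset.mem_univ j))
    have h1 : (1 : ℤ) ≤ ((α j : ℤ) - β j) ^ 2 := by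
      have : (α j : ℤ) - β j ≠ 0 := sub_ne_zero.2 (by exact_mod_cast hj)
      have := sq_pos_of_ne_zero this
      omega
    exact_mod_cast h1
  linarith

theorem sum_sq_le_sq_degree (γ : Fin n →₀ ℕ) : ∑ j, (γ j : ℝ) ^ 2 ≤ (γ.degree : ℝ) ^ 2 := by
  have h : (γ.degree : ℝ) = ∑ j, (γ j : ℝ) := by
    rw [Finsupp.degree_eq_sum]
    push_cast
    rfl
  rw [h, sq (∑ j, (γ j : ℝ)), Finset.sum_mul]
  refine Finset.sum_le_sum fun j _ => ?_
  rw [sq]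
  exact mul_le_mul_of_nonneg_left (Finset.single_le_sum (f := fun j => (γ j : ℝ))
    (fun _ _ => Nat.cast_nonneg _) (Finset.mem_univ j)) (Nat.cast_nonneg _)

/-- The quadratic part can lose at most `d ^ 2`; the linear part outweighs it by `1`. -/
theorem quadraticWeight_shift {v : Fin n → ℝ} {a b : Fin n →₀ ℕ} {d : ℕ}
    (hv : (d : ℝ) ^ 2 + 1 ≤ ∑ j, v j * ((a j : ℝ) - b j)) (γ : Fin n →₀ ℕ)
    (hd : (γ + b).degree ≤ d) :
    quadraticWeight v (γ + b) + 1 ≤ quadraticWeight v (γ + a) := by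
  have hid : quadraticWeight v (γ + a) - quadraticWeight v (γ + b) =
      ∑ j, v j * ((a j : ℝ) - b j) + ∑ j, (((γ + a) j : ℕ) : ℝ) ^ 2 -
        ∑ j, (((γ + b) j : ℕ) : ℝ) ^ 2 := by
    simp only [quadraticWeight, ← Finset.sum_sub_distrib, ← Finset.sum_add_distrib]
    refine Finset.sum_congr rfl fun j _ => ?_
    simp only [Finsupp.add_apply]
    push_cast
    ring
  have h1 := sum_sq_le_sq_degree (γ + b)
  have h2 : ((γ + b).degree : ℝ) ^ 2 ≤ (d : ℝ) ^ 2 := by gcongr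
  have h3 : 0 ≤ ∑ j, (((γ + a) j : ℕ) : ℝ) ^ 2 := Finset.sum_nonneg fun _ _ => sq_nonneg _
  linarith

/-! ### Realizing tropical moments -/

theorem IsTropicalMoment.isStrictMoments {a b : Fin r → Fin n →₀ ℕ} {d : ℕ}
    {h : Exponents n d → ℝ} (hh : IsTropicalMoment a b d h) {v : Fin n → ℝ}
    (hv : ∀ i, a i ≠ b i → (d : ℝ) ^ 2 + 1 ≤ ∑ j, v j * ((a i j : ℝ) - b i j))
    {ε t : ℝ} (hε : 0 < ε) (ht : 1 < t) {w : (Fin n →₀ ℕ) → ℝ}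
    (hw : ∀ γ : Exponents n d, w γ.1 = h γ + ε * quadraticWeight v γ.1) :
    IsStrictMoments a b d (t ^ (-ε)) fun γ => t ^ w γ := by
  have ht0 : 0 < t := by linarith
  refine ⟨fun γ => Real.rpow_pos_of_pos ht0 _, fun i γ hi h₁ h₂ => ?_, fun γ α β hne h₁ h₂ => ?_⟩
  · rw [← Real.rpow_add ht0]
    refine Real.rpow_le_rpow_of_exponent_le ht.le ?_
    rw [hw ⟨_, h₁⟩, hw ⟨_, h₂⟩]
    have := hh.shift i γ h₁ h₂
    have := mul_le_mul_of_nonneg_left (quadraticWeight_shift (hv i hi) γ h₂) hε.le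
    linarith
  · have h₃ : (γ + α + β).degree ≤ d := by
      simp only [map_add, map_nsmul, smul_eq_mul] at h₁ h₂ ⊢
      omega
    simp only [← Real.rpow_natCast, ← Real.rpow_mul ht0.le, ← Real.rpow_add ht0]
    refine Real.rpow_le_rpow_of_exponent_le ht.le ?_
    rw [hw ⟨_, h₁⟩, hw ⟨_, h₂⟩, hw ⟨_, h₃⟩]
    have := hh.mid γ α β h₁ h₂ h₃
    have := mul_le_mul_of_nonneg_left (quadraticWeight_mid v γ hne) hε.le
    push_cast
    linarith

theorem IsTropicalMoment.mem_tropDual {a b : Fin r → Fin n →₀ ℕ} {d : ℕ}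
    (hS : (interior (orthantSet fun i => pureBinomial (a i) (b i))).Nonempty)
    {h : Exponents n d → ℝ} (hh : IsTropicalMoment a b d h) :
    h ∈ tropDual d (truncPO (fun i => pureBinomial (a i) (b i)) d) := by
  classical
  intro U hU
  obtain ⟨v, hv⟩ := exists_forall_le_sum_mul_sub hS ((d : ℝ) ^ 2 + 1)
  have hev : ∀ᶠ ε : ℝ in 𝓝[>] 0,
      (fun γ : Exponents n d => h γ + ε * quadraticWeight v γ.1) ∈ U := by
    have hc : Continuous fun ε : ℝ => fun γ : Exponents n d =>
        h γ + ε * quadraticWeight v γ.1 := by fun_prop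
    have := hc.tendsto 0
    simp only [zero_mul, add_zero] at this
    exact (this.mono_left nhdsWithin_le_nhds).eventually hU
  obtain ⟨ε, hεU, hε⟩ := (hev.and self_mem_nhdsWithin).exists
  have hε : 0 < ε := hε
  -- The default `0` above degree `d` is harmless: there only positivity of `t ^ w γ` is required.
  set w : (Fin n →₀ ℕ) → ℝ := fun γ =>
    (if hγ : γ.degree ≤ d then h ⟨γ, hγ⟩ else 0) + ε * quadraticWeight v γ with hwdef
  have hw : ∀ γ : Exponents n d, w γ.1 = h γ + ε * quadraticWeight v γ.1 := fun γ => by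
    simp [hwdef, dif_pos γ.2]
  have hsmall : ∀ c : ℝ, ∀ᶠ t : ℝ in atTop, c * t ^ (-ε) ≤ 1 / 2 := fun c => by
    have := (tendsto_rpow_neg_atTop hε).const_mul c
    rw [mul_zero] at this
    exact this.eventually_le_const (by norm_num)
  -- With `ε` fixed by `U`, every large `t` works, since `t ^ (-ε) → 0`.
  refine Eventually.frequently ?_
  filter_upwards [eventually_gt_atTop 1, hsmall r, hsmall (exponentsLE n d).card] with t ht hr hN
  have ht0 : 0 < t := by linarith
  have hW := hh.isStrictMoments hv hε ht hw
  set L := momentFunctional fun γ => t ^ w γ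
  have hL : ∀ γ, moments (L.domRestrict (restrictTotalDegree (Fin n) ℝ d)) γ = t ^ w γ.1 :=
    fun γ => momentFunctional_monomial _ _
  refine ⟨_, ⟨L.domRestrict (restrictTotalDegree (Fin n) ℝ d), fun f hf => ?_, rfl⟩,
    fun γ => ?_, ?_⟩
  · exact hW.nonneg_of_mem_truncPO (Real.rpow_nonneg ht0.le _) hr hN hf
  · rw [hL]
    exact (Real.rpow_pos_of_pos ht0 _).ne'
  · convert hεU using 2 with γ
    rw [hL, abs_of_pos (Real.rpow_pos_of_pos ht0 _), Real.logb_rpow ht0 ht.ne', hw]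

end TropMoment

theorem mainTheorem7 {n r : ℕ} (a b : Fin r → Fin n →₀ ℕ)
    (hS : (interior (TropMoment.orthantSet
      (fun i => TropMoment.pureBinomial (a i) (b i)))).Nonempty)
    (A : Finset (Fin n →₀ ℕ)) (d : ℕ) (hA : ∀ γ ∈ A, γ.degree ≤ d) :
    (TropMoment.proj A hA '' TropMoment.tropDual d
        (TropMoment.truncPO (fun i => TropMoment.pureBinomial (a i) (b i)) d) ⊆
      TropMoment.proj A hA '' TropMoment.tropDual d
        (TropMoment.truncQM (fun i => TropMoment.pureBinomial (a i) (b i)) d)) ∧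
    ∃ D₀ : ℕ, d ≤ D₀ ∧ ∀ D : ℕ, D₀ ≤ D → ∀ hD : ∀ γ ∈ A, γ.degree ≤ D,
      TropMoment.proj A hD '' TropMoment.tropDual D
          (TropMoment.truncQM (fun i => TropMoment.pureBinomial (a i) (b i)) D) ⊆
        TropMoment.proj A hA '' TropMoment.tropDual d
          (TropMoment.truncPO (fun i => TropMoment.pureBinomial (a i) (b i)) d) := by
  -- Already `D₀ = d` suffices: truncation to degree `d` keeps the coordinates in `A`.
  refine ⟨Set.image_mono (TropMoment.tropDual_anti d (TropMoment.truncQM_subset_truncPO _ d)),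
    d, le_rfl, fun D hdD hD => ?_⟩
  rintro _ ⟨h, hh, rfl⟩
  exact ⟨_, ((TropMoment.isTropicalMoment_of_mem_tropDual hh).restrict hdD).mem_tropDual hS, rfl⟩
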